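/- Let $F$ be a real Banach lattice which is $\sigma$-Dedekind complete (every nonempty countable subset that is bounded above has a supremum), and let $E=F\oplus iF$ be its complexification, with modulus $|x+iy|=\sup_{\theta\in[0,2\pi)}(x\cos\theta+y\sin\theta)\in F$, norm $\|z\|=\|\,|z|\,\|_F$ and positive cone $E_+=F_+$. A net $(v_\alpha)$ in $F$ converges in order to $v$ if there is a net $(y_\gamma)$ in $F$, possibly over another directed set, with $y_\gamma\downarrow 0$ and such that for every $\gamma$ there is $\alpha_0$ with $|v_\alpha-v|\le y_\gamma$ for all $\alpha\ge\alpha_0$. A net $(x_\alpha)$ in $E$ is $uo$-convergent to $x\in E$ if for every $u\in E_+$ the net $|x_\alpha-x|\wedge u$ converges in order to $0$. Then the following conditions are equivalent: 1. $E$ is a Brezis–Lieb space: for every net $(x_\alpha)$ in $E$ and every $x\in E$, if $(x_\alpha)$ is $uo$-convergent to $x$ and $\|x_\alpha\|\to\|x\|$, then $\|x_\alpha-x\|\to 0$. 2. $E$ is a $\sigma$-Brezis–Lieb space: for every sequence $(x_n)$ in $E$ and every $x\in E$, if $(x_n)$ is $uo$-convergent to $x$ and $\|x_n\|\to\|x\|$,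 then $\|x_n-x\|\to 0$. 3. $E$ has the Brezis–Lieb property, that is, $\limsup_{n\to\infty}\|u_0+u_n\|>\|u_0\|$ for every $u_0\in E_+$ and every sequence $(u_n)$ in $E_+$ with $\|u_n\|=1$ for all $n$ and $u_m\wedge u_n=0$ for $m\ne n$; and the norm of $E$ is order continuous, that is, $\|y_\gamma\|\to 0$ for every net $(y_\gamma)$ in $E_+$ with $y_\gamma\downarrow 0$. -/

import Mathlib

section RealLattice

/-- Every nonempty countable subset which is bounded above has a supremum. -/
def IsSigmaDedekindComplete (F : Type*) [Lattice F] : Prop :=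
  ∀ s : Set F, s.Countable → s.Nonempty → BddAbove s → ∃ m, IsLUB s m

/-- Order convergence of a net `v` to `x` in a vector lattice: there is a net `y` (possibly over
another directed set) decreasing to `0` such that, for every index `c` of `y`, eventually
`|v a - x| ≤ y c`. (Replacing `y` by its range, one sees that letting the index set of `y` live
in the universe of `F` is no restriction.) -/
def OrderConverges.{w, u} {ι : Type w} [Preorder ι] {F : Type u} [AddCommGroup F] [Lattice F]
    (v : ι → F) (x : F) : Prop :=
  ∃ (κ : Type u) (_ : Preorder κ) (_ : IsDirectedOrder κ) (_ : Nonempty κ) (y : κ → F),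
    Antitone y ∧ IsGLB (Set.range y) 0 ∧ ∀ c, ∃ a₀, ∀ a, a₀ ≤ a → |v a - x| ≤ y c

end RealLattice

/-- The complexification `F ⊕ iF`. -/
@[ext]
structure Complexification (F : Type*) where
  re : F
  im : F

namespace Complexification

section Algebra

variable {F : Type*} [AddCommGroup F]

instance : Zero (Complexification F) := ⟨⟨0, 0⟩⟩
instance : Add (Complexification F) := ⟨fun z w => ⟨z.re + w.re, z.im + w.im⟩⟩
instance : Neg (Complexification F) := ⟨fun z => ⟨-z.re, -z.im⟩⟩
instance : Sub (Complexification F) := ⟨fun z w => ⟨z.re - w.re, z.im - w.im⟩⟩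
instance [Module ℝ F] : SMul ℂ (Complexification F) :=
  ⟨fun c z => ⟨c.re • z.re - c.im • z.im, c.re • z.im + c.im • z.re⟩⟩

@[simp] theorem zero_re : (0 : Complexification F).re = 0 := rfl
@[simp] theorem zero_im : (0 : Complexification F).im = 0 := rfl
@[simp] theorem add_re (z w : Complexification F) : (z + w).re = z.re + w.re := rfl
@[simp] theorem add_im (z w : Complexification F) : (z + w).im = z.im + w.im := rfl
@[simp] theorem neg_re (z : Complexification F) : (-z).re = -z.re := rfl
@[simp] theorem neg_im (z : Complexification F) : (-z).im = -z.im := rfl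
@[simp] theorem sub_re (z w : Complexification F) : (z - w).re = z.re - w.re := rfl
@[simp] theorem sub_im (z w : Complexification F) : (z - w).im = z.im - w.im := rfl
@[simp] theorem smul_re [Module ℝ F] (c : ℂ) (z : Complexification F) :
    (c • z).re = c.re • z.re - c.im • z.im := rfl
@[simp] theorem smul_im [Module ℝ F] (c : ℂ) (z : Complexification F) :
    (c • z).im = c.re • z.im + c.im • z.re := rfl

instance : AddCommGroup (Complexification F) where
  add_assoc a b c := by ext <;> simp [add_assoc]
  zero_add a := by ext <;> simp
  add_zero a := by ext <;> simp
  add_comm a b := by ext <;> simp [add_comm]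
  neg_add_cancel a := by ext <;> simp
  sub_eq_add_neg a b := by ext <;> simp [sub_eq_add_neg]
  nsmul := nsmulRec
  zsmul := zsmulRec

instance [Module ℝ F] : Module ℂ (Complexification F) where
  one_smul a := by ext <;> simp
  mul_smul a b c := by ext <;> simp <;> module
  smul_zero a := by ext <;> simp
  smul_add a b c := by ext <;> simp <;> module
  add_smul a b c := by ext <;> simp <;> module
  zero_smul a := by ext <;> simp

/-- The canonical embedding of `F` as the real part of `F ⊕ iF`. The positive cone of the
complexification is the image of the positive cone of `F`. -/
def ofReal (x : F) : Complexification F := ⟨x, 0⟩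

/-- The element `x cos θ + y sin θ` for `z = x + iy`. -/
noncomputable def rot [Module ℝ F] (z : Complexification F) (θ : ℝ) : F :=
  Real.cos θ • z.re + Real.sin θ • z.im

theorem rot_add_two_pi [Module ℝ F] (z : Complexification F) (θ : ℝ) : z.rot (θ + 2 * Real.pi) = z.rot θ := by
  simp [rot]

theorem exists_rot_eq [Module ℝ F] (z : Complexification F) (θ : ℝ) :
    ∃ t ∈ Set.Ico 0 (2 * Real.pi), z.rot θ = z.rot t :=
  Function.Periodic.exists_mem_Ico₀ (f := z.rot) z.rot_add_two_pi Real.two_pi_pos θ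

end Algebra

section Modulus

variable {F : Type*} [NormedAddCommGroup F] [NormedSpace ℝ F] [Lattice F] [IsOrderedAddMonoid F]
  [IsOrderedModule ℝ F] [HasSolidNorm F]


theorem rot_le_add (z : Complexification F) (θ t : ℝ) :
    z.rot θ ≤ z.rot t + |θ - t| • (|z.re| + |z.im|) := by
  have key : ∀ (a b d : ℝ) (x : F), |a - b| ≤ d → a • x ≤ b • x + d • |x| := by
    intro a b d x h
    have h1 : (a - b) • x ≤ d • |x| := by
      have h2 : |a - b| • |x| ≤ d • |x| := smul_le_smul_of_nonneg_right h (abs_nonneg x)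
      refine le_trans ?_ h2
      rcases le_total 0 (a - b) with h0 | h0
      · rw [abs_of_nonneg h0]
        exact smul_le_smul_of_nonneg_left (le_abs_self x) h0
      · rw [abs_of_nonpos h0]
        calc (a - b) • x = (-(a - b)) • (-x) := by module
          _ ≤ _ := smul_le_smul_of_nonneg_left (neg_le_abs x) (neg_nonneg.2 h0)
    calc a • x = b • x + (a - b) • x := by module
      _ ≤ _ := by gcongr
  have h1 := key (Real.cos θ) (Real.cos t) |θ - t| z.re (Real.abs_cos_sub_cos_le θ t)
  have h2 := key (Real.sin θ) (Real.sin t) |θ - t| z.im (Real.abs_sin_sub_sin_le θ t)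
  calc z.rot θ ≤ _ := add_le_add h1 h2
    _ = _ := by simp only [rot]; module

/-- In a Banach lattice the supremum defining the modulus exists. -/
theorem exists_modulus [CompleteSpace F] (z : Complexification F) :
    ∃ m : F, IsLUB (z.rot '' Set.Ico 0 (2 * Real.pi)) m := by
  set e : F := |z.re| + |z.im| with he
  have he0 : 0 ≤ e := add_nonneg (abs_nonneg _) (abs_nonneg _)
  -- approximate suprema, taken over finite grids
  have grid : ∀ n : ℕ, ∃ s : F,
      (∀ b ∈ upperBounds (z.rot '' Set.Ico 0 (2 * Real.pi)), s ≤ b) ∧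
      ∀ θ ∈ Set.Ico 0 (2 * Real.pi), z.rot θ ≤ s + (1 / ((n : ℝ) + 1)) • e := by
    intro n
    have hn : (0 : ℝ) < (n : ℝ) + 1 := by positivity
    set N : ℕ := ⌊2 * Real.pi * ((n : ℝ) + 1)⌋₊ with hN
    refine ⟨(Finset.range (N + 1)).sup' ⟨0, by simp⟩ fun k => z.rot ((k : ℝ) / ((n : ℝ) + 1)),
      ?_, ?_⟩
    · intro b hb
      refine Finset.sup'_le _ _ fun k _ => ?_
      obtain ⟨t, ht, hkt⟩ := z.exists_rot_eq ((k : ℝ) / ((n : ℝ) + 1))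
      rw [hkt]
      exact hb ⟨t, ht, rfl⟩
    · intro θ hθ
      set k : ℕ := ⌊θ * ((n : ℝ) + 1)⌋₊ with hk
      have hkN : k ∈ Finset.range (N + 1) := by
        have : k ≤ N := Nat.floor_le_floor (by nlinarith [hθ.2])
        simpa [Finset.mem_range] using Nat.lt_succ_of_le this
      have h1 : (k : ℝ) ≤ θ * ((n : ℝ) + 1) := Nat.floor_le (mul_nonneg hθ.1 hn.le)
      have h2 : θ * ((n : ℝ) + 1) < k + 1 := Nat.lt_floor_add_one _
      have h3 : |θ - (k : ℝ) / ((n : ℝ) + 1)| ≤ 1 / ((n : ℝ) + 1) := by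
        have : θ - (k : ℝ) / ((n : ℝ) + 1) = (θ * ((n : ℝ) + 1) - k) / ((n : ℝ) + 1) := by
          field_simp
        rw [this, abs_of_nonneg (div_nonneg (by linarith) hn.le)]
        exact div_le_div_of_nonneg_right (by linarith) hn.le
      refine (z.rot_le_add θ ((k : ℝ) / ((n : ℝ) + 1))).trans (add_le_add ?_ ?_)
      · exact Finset.le_sup' (fun k : ℕ => z.rot ((k : ℝ) / ((n : ℝ) + 1))) hkN
      · exact smul_le_smul_of_nonneg_right h3 he0
  choose s hs1 hs2 using grid
  have hcomp : ∀ m n, s m ≤ s n + (1 / ((n : ℝ) + 1)) • e := fun m n =>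
    hs1 m _ (by rintro _ ⟨θ, hθ, rfl⟩; exact hs2 n θ hθ)
  have hlim0 : Filter.Tendsto (fun n : ℕ => (1 / ((n : ℝ) + 1)) * ‖e‖) Filter.atTop (nhds 0) := by
    simpa using (tendsto_one_div_add_atTop_nhds_zero_nat (𝕜 := ℝ)).mul_const ‖e‖
  have hcau : CauchySeq s := by
    refine cauchySeq_of_le_tendsto_0' (fun n : ℕ => (1 / ((n : ℝ) + 1)) * ‖e‖) ?_ hlim0
    intro n m hnm
    have hd : (0 : ℝ) ≤ 1 / ((n : ℝ) + 1) := by positivity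
    have hle : (1 / ((m : ℝ) + 1)) • e ≤ (1 / ((n : ℝ) + 1)) • e := by
      refine smul_le_smul_of_nonneg_right ?_ he0
      gcongr
    have habs : |s n - s m| ≤ |(1 / ((n : ℝ) + 1)) • e| := by
      refine le_trans ?_ (le_abs_self _)
      refine abs_le'.2 ⟨?_, ?_⟩
      · rw [sub_le_iff_le_add']
        exact (hcomp n m).trans (by gcongr)
      · rw [neg_sub, sub_le_iff_le_add']
        exact hcomp m n
    rw [dist_eq_norm]
    refine (norm_le_norm_of_abs_le_abs habs).trans ?_
    rw [norm_smul, Real.norm_of_nonneg hd]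
  obtain ⟨m, hm⟩ := cauchySeq_tendsto_of_complete hcau
  refine ⟨m, ?_, fun b hb => le_of_tendsto' hm fun n => hs1 n b hb⟩
  rintro _ ⟨θ, hθ, rfl⟩
  have h1 : Filter.Tendsto (fun n : ℕ => s n + (1 / ((n : ℝ) + 1)) • e) Filter.atTop
      (nhds (m + (0 : ℝ) • e)) :=
    hm.add ((tendsto_one_div_add_atTop_nhds_zero_nat (𝕜 := ℝ)).smul_const e)
  rw [zero_smul, add_zero] at h1
  exact ge_of_tendsto' h1 fun n => hs2 n θ hθ

/-- The modulus `|x + iy| = sup {x cos θ + y sin θ : θ ∈ [0, 2π)}`, an element of `F`. -/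
noncomputable def modulus [CompleteSpace F] (z : Complexification F) : F :=
  Classical.choose z.exists_modulus

variable [CompleteSpace F]

theorem isLUB_modulus (z : Complexification F) :
    IsLUB (z.rot '' Set.Ico 0 (2 * Real.pi)) z.modulus :=
  Classical.choose_spec z.exists_modulus

theorem rot_le_modulus (z : Complexification F) (θ : ℝ) : z.rot θ ≤ z.modulus := by
  obtain ⟨t, ht, h⟩ := z.exists_rot_eq θ
  rw [h]
  exact z.isLUB_modulus.1 ⟨t, ht, rfl⟩

theorem modulus_le {z : Complexification F} {b : F} (h : ∀ θ, z.rot θ ≤ b) : z.modulus ≤ b :=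
  z.isLUB_modulus.2 (by rintro _ ⟨θ, _, rfl⟩; exact h θ)

theorem abs_re_le_modulus (z : Complexification F) : |z.re| ≤ z.modulus :=
  abs_le'.2 ⟨by simpa [rot] using z.rot_le_modulus 0,
    by simpa [rot] using z.rot_le_modulus Real.pi⟩

theorem abs_im_le_modulus (z : Complexification F) : |z.im| ≤ z.modulus :=
  abs_le'.2 ⟨by simpa [rot] using z.rot_le_modulus (Real.pi / 2),
    by simpa [rot] using z.rot_le_modulus (-(Real.pi / 2))⟩

theorem modulus_nonneg (z : Complexification F) : 0 ≤ z.modulus :=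
  (abs_nonneg _).trans z.abs_re_le_modulus

theorem modulus_add_le (z w : Complexification F) :
    (z + w).modulus ≤ z.modulus + w.modulus := by
  refine modulus_le fun θ => ?_
  calc (z + w).rot θ = z.rot θ + w.rot θ := by simp only [rot, add_re, add_im]; module
    _ ≤ _ := add_le_add (z.rot_le_modulus θ) (w.rot_le_modulus θ)

theorem modulus_smul_le (c : ℂ) (z : Complexification F) :
    (c • z).modulus ≤ ‖c‖ • z.modulus := by
  refine modulus_le fun θ => ?_
  have h : (c • z).rot θ = ‖c‖ • z.rot (θ - c.arg) := by
    have h1 := Complex.norm_mul_cos_arg c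
    have h2 := Complex.norm_mul_sin_arg c
    simp only [rot, smul_re, smul_im, Real.cos_sub, Real.sin_sub]
    rw [← h1, ← h2]
    module
  rw [h]
  exact smul_le_smul_of_nonneg_left (z.rot_le_modulus _) (norm_nonneg c)

theorem modulus_neg (z : Complexification F) : (-z).modulus = z.modulus := by
  have h : ∀ w : Complexification F, (-w).modulus ≤ w.modulus := fun w => by
    simpa using modulus_smul_le (-1) w
  refine le_antisymm (h z) ?_
  simpa using h (-z)

theorem modulus_ofReal (x : F) : (ofReal x).modulus = |x| := by
  refine le_antisymm (modulus_le fun θ => ?_) (abs_re_le_modulus (ofReal x))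
  have h1 : Real.cos θ • x ≤ |x| := by
    rcases le_total 0 (Real.cos θ) with h0 | h0
    · calc Real.cos θ • x ≤ Real.cos θ • |x| := smul_le_smul_of_nonneg_left (le_abs_self x) h0
        _ ≤ (1 : ℝ) • |x| := smul_le_smul_of_nonneg_right (Real.cos_le_one θ) (abs_nonneg x)
        _ = |x| := one_smul _ _
    · calc Real.cos θ • x = (-Real.cos θ) • (-x) := by simp
        _ ≤ (-Real.cos θ) • |x| := smul_le_smul_of_nonneg_left (neg_le_abs x) (neg_nonneg.2 h0)
        _ ≤ (1 : ℝ) • |x| :=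
          smul_le_smul_of_nonneg_right (by linarith [Real.neg_one_le_cos θ]) (abs_nonneg x)
        _ = |x| := one_smul _ _
  simpa [rot, ofReal] using h1

theorem modulus_zero : (0 : Complexification F).modulus = 0 := by
  exact (modulus_ofReal (0 : F)).trans abs_zero

/-- The norm of the complexification is `‖z‖ = ‖ |z| ‖`. -/
noncomputable instance : NormedAddCommGroup (Complexification F) :=
  AddGroupNorm.toNormedAddCommGroup
    { toFun := fun z => ‖z.modulus‖
      map_zero' := by simp [modulus_zero]
      add_le' := fun z w => by
        refine le_trans (norm_le_norm_of_abs_le_abs ?_) (norm_add_le _ _)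
        rw [abs_of_nonneg (modulus_nonneg _),
          abs_of_nonneg (add_nonneg (modulus_nonneg _) (modulus_nonneg _))]
        exact modulus_add_le z w
      neg' := fun z => by rw [modulus_neg]
      eq_zero_of_map_eq_zero' := fun z hz => by
        have h0 : z.modulus = 0 := norm_eq_zero.1 hz
        have h1 := z.abs_re_le_modulus
        have h2 := z.abs_im_le_modulus
        rw [h0] at h1 h2
        have key : ∀ x : F, |x| ≤ 0 → x = 0 := fun x h =>
          le_antisymm ((le_abs_self x).trans h) (neg_nonpos.1 ((neg_le_abs x).trans h))
        ext
        · exact key _ h1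
        · exact key _ h2 }

theorem norm_def (z : Complexification F) : ‖z‖ = ‖z.modulus‖ := rfl

noncomputable instance : NormedSpace ℂ (Complexification F) where
  norm_smul_le c z := by
    rw [norm_def, norm_def]
    have h : ‖‖c‖ • z.modulus‖ = ‖c‖ * ‖z.modulus‖ := by rw [norm_smul, norm_norm]
    rw [← h]
    refine norm_le_norm_of_abs_le_abs ?_
    rw [abs_of_nonneg (modulus_nonneg _),
      abs_of_nonneg (smul_nonneg (norm_nonneg c) (modulus_nonneg z))]
    exact modulus_smul_le c z

theorem norm_ofReal (x : F) : ‖ofReal x‖ = ‖x‖ := by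
  rw [norm_def, modulus_ofReal, norm_abs_eq_norm]

theorem norm_re_le (z : Complexification F) : ‖z.re‖ ≤ ‖z‖ :=
  norm_le_norm_of_abs_le_abs (z.abs_re_le_modulus.trans (le_abs_self _))

theorem norm_im_le (z : Complexification F) : ‖z.im‖ ≤ ‖z‖ :=
  norm_le_norm_of_abs_le_abs (z.abs_im_le_modulus.trans (le_abs_self _))

theorem norm_le_add (z : Complexification F) : ‖z‖ ≤ ‖z.re‖ + ‖z.im‖ := by
  have h : z = ofReal z.re + Complex.I • ofReal z.im := by ext <;> simp [ofReal]
  calc ‖z‖ = ‖ofReal z.re + Complex.I • ofReal z.im‖ := by rw [← h]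
    _ ≤ ‖ofReal z.re‖ + ‖Complex.I • ofReal z.im‖ := norm_add_le _ _
    _ = _ := by rw [norm_smul, Complex.norm_I, one_mul, norm_ofReal, norm_ofReal]

/-- The complexification of a Banach lattice is a Banach space. -/
instance : CompleteSpace (Complexification F) := by
  refine Metric.complete_of_cauchySeq_tendsto fun v hv => ?_
  have aux : ∀ f : Complexification F → F, (∀ z w, ‖f z - f w‖ ≤ ‖z - w‖) →
      CauchySeq fun n => f (v n) := by
    intro f hf
    rw [Metric.cauchySeq_iff] at hv ⊢
    intro ε hε
    obtain ⟨N, hN⟩ := hv ε hε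
    refine ⟨N, fun m hm n hn => lt_of_le_of_lt ?_ (hN m hm n hn)⟩
    rw [dist_eq_norm, dist_eq_norm]
    exact hf _ _
  obtain ⟨x, hx⟩ := cauchySeq_tendsto_of_complete (aux re fun z w => norm_re_le (z - w))
  obtain ⟨y, hy⟩ := cauchySeq_tendsto_of_complete (aux im fun z w => norm_im_le (z - w))
  have h := (tendsto_iff_norm_sub_tendsto_zero.1 hx).add (tendsto_iff_norm_sub_tendsto_zero.1 hy)
  rw [add_zero] at h
  have h0 : Filter.Tendsto (fun n => ‖v n - Complexification.mk x y‖) Filter.atTop (nhds 0) :=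
    squeeze_zero (fun n => norm_nonneg (v n - Complexification.mk x y))
      (fun n => norm_le_add (v n - Complexification.mk x y)) h
  exact ⟨Complexification.mk x y, tendsto_iff_norm_sub_tendsto_zero.2 h0⟩

end Modulus

end Complexification

section BrezisLieb

open Complexification

/-- Unbounded order convergence of a net `v` to `x` in the complexification of `F`: for every
`u ≥ 0` the net `|v a - x| ⊓ u` converges in order to `0`. -/
def UOConverges {ι : Type*} [Preorder ι] {F : Type*} [NormedAddCommGroup F] [NormedSpace ℝ F]
    [Lattice F] [IsOrderedAddMonoid F] [IsOrderedModule ℝ F] [HasSolidNorm F] [CompleteSpace F]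
    (v : ι → Complexification F) (x : Complexification F) : Prop :=
  ∀ u : F, 0 ≤ u → OrderConverges (fun a => (v a - x).modulus ⊓ u) 0

/-- The complexification of `F` is a Brezis-Lieb space, for nets indexed by directed sets in an
arbitrary universe `w`. -/
def IsBrezisLiebSpace.{w, u} (F : Type u) [NormedAddCommGroup F] [NormedSpace ℝ F]
    [Lattice F] [IsOrderedAddMonoid F] [IsOrderedModule ℝ F] [HasSolidNorm F] [CompleteSpace F] :
    Prop :=
  ∀ (ι : Type w) [Preorder ι] [IsDirectedOrder ι] [Nonempty ι]
    (v : ι → Complexification F) (x : Complexification F),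
    UOConverges v x → Filter.Tendsto (fun a => ‖v a‖) Filter.atTop (nhds ‖x‖) →
      Filter.Tendsto (fun a => ‖v a - x‖) Filter.atTop (nhds 0)

/-- The complexification of `F` is a σ-Brezis-Lieb space. -/
def IsSigmaBrezisLiebSpace (F : Type*) [NormedAddCommGroup F] [NormedSpace ℝ F]
    [Lattice F] [IsOrderedAddMonoid F] [IsOrderedModule ℝ F] [HasSolidNorm F] [CompleteSpace F] :
    Prop :=
  ∀ (v : ℕ → Complexification F) (x : Complexification F),
    UOConverges v x → Filter.Tendsto (fun n => ‖v n‖) Filter.atTop (nhds ‖x‖) →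
      Filter.Tendsto (fun n => ‖v n - x‖) Filter.atTop (nhds 0)

/-- The Brezis-Lieb property of the complexification of `F` (its positive cone is that of `F`).
The sequence below is bounded, by `‖u₀‖ + 1`, so its real `limsup` is the usual one. -/
def HasBrezisLiebProperty (F : Type*) [NormedAddCommGroup F] [NormedSpace ℝ F]
    [Lattice F] [IsOrderedAddMonoid F] [IsOrderedModule ℝ F] [HasSolidNorm F] [CompleteSpace F] :
    Prop :=
  ∀ (u₀ : F) (u : ℕ → F), 0 ≤ u₀ → (∀ n, 0 ≤ u n) → (∀ n, ‖ofReal (u n)‖ = 1) →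
    (∀ m n, m ≠ n → u m ⊓ u n = 0) →
    ‖ofReal u₀‖ < Filter.limsup (fun n => ‖ofReal u₀ + ofReal (u n)‖) Filter.atTop

/-- The norm of the complexification of `F` is order continuous: `‖y a‖ → 0` for every net `y` in
the positive cone decreasing to `0`. (Replacing `y` by its range, one sees that index sets in the
universe of `F` suffice.) -/
def HasOrderContinuousNorm.{u} (F : Type u) [NormedAddCommGroup F] [NormedSpace ℝ F]
    [Lattice F] [IsOrderedAddMonoid F] [IsOrderedModule ℝ F] [HasSolidNorm F] [CompleteSpace F] :
    Prop :=
  ∀ (κ : Type u) [Preorder κ] [IsDirectedOrder κ] [Nonempty κ] (y : κ → F),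
    Antitone y → IsGLB (Set.range y) 0 →
      Filter.Tendsto (fun c => ‖ofReal (y c)‖) Filter.atTop (nhds 0)

end BrezisLieb

universe w u

open Filter Topology

/-! ### Order-theoretic facts in vector lattices -/

section VectorLattice

/-! The implication from nets to sequences is immediate, and σ-Dedekind completeness is needed only
to pass from sequences to condition 3.

From 2 to 3: let `y n ↓ 0`, put `u = y 0`, and let `w n` be the component of `u` in the band
generated by `(y n - δ u)⁺`. Then `|u - 2 w n| = u`, so `u - 2 w n` has the norm of `u`, and it
converges to `u` because `w n ≤ δ⁻¹ y n`. The σ-Brezis–Lieb property gives `‖w n‖ → 0`, and `y n ≤ δ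
u + w n` then makes `‖y n‖` small. Completeness extends this from sequences to nets. For the
Brezis–Lieb property, a disjoint sequence `u n` is uo-null; were the limsup at most `‖u₀‖`, then `u₀
+ u n` would have to converge to `u₀` in norm, against `‖u n‖ = 1`.

From 3 to 1: put `z a = |v a - x|`. Order continuity makes `z a ⊓ b` norm small for each fixed `b ≥
0`. Hence `|x|` and `z a` are almost disjoint, and `‖|x| + z a‖` is asymptotically at most `‖x‖`. If
`‖z a‖` does not tend to `0`, one selects an almost disjoint sequence of the `z a` bounded away from
`0`, and below it a genuinely disjoint one, which contradicts the Brezis–Lieb property. -/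

theorem IsSigmaDedekindComplete.exists_isLUB_range {F : Type*} [Lattice F]
    (hF : IsSigmaDedekindComplete F) {ι : Type*} [Countable ι] [Nonempty ι] (f : ι → F)
    {b : F} (hb : ∀ i, f i ≤ b) :
    ∃ m, IsLUB (Set.range f) m :=
  hF _ (Set.countable_range f) (Set.range_nonempty f) ⟨b, by rintro _ ⟨i, rfl⟩; exact hb i⟩

theorem OrderConverges.of_abs_le_antitone {F : Type*} [AddCommGroup F] [Lattice F]
    {v y : ℕ → F} (hy : Antitone y)
    (h0 : IsGLB (Set.range y) 0) (h : ∀ n, |v n| ≤ y n) : OrderConverges v 0 := by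
  refine ⟨ULift ℕ, inferInstance, inferInstance, inferInstance, fun n => y n.down,
    fun m n hmn => hy hmn, ?_, fun c => ⟨c.down, fun a ha => ?_⟩⟩
  · rwa [show Set.range (fun n : ULift ℕ => y n.down) = Set.range y from
      ULift.down_surjective.range_comp y]
  · rw [sub_zero]
    exact (h a).trans (hy ha)

theorem smul_inf_of_pos {F : Type*} [AddCommGroup F] [Lattice F] [Module ℝ F]
    [IsOrderedModule ℝ F] {c : ℝ} (hc : 0 < c) (a b : F) :
    c • (a ⊓ b) = c • a ⊓ c • b :=
  (OrderIso.smulRight (β := F) hc).map_inf a b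

variable {F : Type*} [AddCommGroup F] [Lattice F] [IsOrderedAddMonoid F]

theorem inf_add_le_inf_add_inf {a b c : F} (ha : 0 ≤ a) (hb : 0 ≤ b) (hc : 0 ≤ c) :
    a ⊓ (b + c) ≤ a ⊓ b + a ⊓ c := by
  rw [inf_add, add_inf, add_inf]
  refine le_inf (le_inf ?_ ?_) (le_inf ?_ ?_)
  · exact inf_le_left.trans (le_add_of_nonneg_left ha)
  · exact inf_le_left.trans (le_add_of_nonneg_right hc)
  · exact inf_le_left.trans (le_add_of_nonneg_left hb)
  · exact inf_le_right

theorem abs_sub_eq_add_of_inf_eq_zero {a b : F} (h : a ⊓ b = 0) : |a - b| = a + b := by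
  rw [abs_sub_comm, ← sup_sub_inf_eq_abs_sub, h, sub_zero, ← inf_add_sup a b, h, zero_add]

theorem add_sub_two_inf_eq_abs_sub (a b : F) : a + b - (a ⊓ b + a ⊓ b) = |a - b| := by
  rw [abs_sub_comm, ← sup_sub_inf_eq_abs_sub, ← inf_add_sup a b]
  abel

theorem sub_inf_inf_sub_inf (a b : F) : (a - a ⊓ b) ⊓ (b - a ⊓ b) = 0 := by
  rw [sub_eq_add_neg, sub_eq_add_neg, ← inf_add, add_neg_cancel]

/-- Infinite distributivity: `x + u = x ⊓ u + x ⊔ u` turns the bounds on `x ⊓ u` into one upper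
bound for `s`. -/
theorem IsLUB.inf_le_of_forall_inf_le {s : Set F} {m u c : F} (h : IsLUB s m)
    (hs : ∀ x ∈ s, x ⊓ u ≤ c) : m ⊓ u ≤ c := by
  have h1 : m ≤ c + m ⊔ u - u := h.2 fun x hx => by
    have h2 := add_le_add (hs x hx) (sup_le_sup_right (h.1 hx) u)
    rw [inf_add_sup] at h2
    exact le_sub_iff_add_le.2 h2
  rw [le_sub_iff_add_le, ← inf_add_sup m u] at h1
  exact le_of_add_le_add_right h1

/-- A disjoint sequence in a `σ`-Dedekind complete vector lattice converges to `0` in the unbounded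
order sense. -/
theorem OrderConverges.inf_of_pairwise_disjoint (hF : IsSigmaDedekindComplete F) {u : ℕ → F}
    (hu : ∀ n, 0 ≤ u n) (hd : ∀ m n, m ≠ n → u m ⊓ u n = 0) {b : F} (hb : 0 ≤ b) :
    OrderConverges (fun n => u n ⊓ b) 0 := by
  have hex : ∀ n : ℕ, ∃ m, IsLUB (Set.range fun k : ℕ => u (n + k) ⊓ b) m := fun n =>
    hF.exists_isLUB_range _ fun _ => inf_le_right
  choose w hw using hex
  have hle : ∀ n k, n ≤ k → u k ⊓ b ≤ w n := fun n k hnk =>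
    (hw n).1 ⟨k - n, by simp [Nat.add_sub_cancel' hnk]⟩
  have hpos : ∀ n, 0 ≤ u n ⊓ b := fun n => le_inf (hu n) hb
  refine OrderConverges.of_abs_le_antitone (y := w) (fun m n hmn => ?_) ⟨?_, ?_⟩ fun n => ?_
  · refine (hw n).2 ?_
    rintro _ ⟨k, rfl⟩
    exact hle m _ (hmn.trans (Nat.le_add_right n k))
  · rintro _ ⟨n, rfl⟩
    exact (hpos n).trans (hle n n le_rfl)
  · intro c hc
    have hc' : ∀ n, c ≤ w n := fun n => hc ⟨n, rfl⟩
    -- `u n` is disjoint from all later terms, hence from the tail supremum `w (n + 1)`, which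
    -- dominates `c`. So `c` meets every `u n`, and then `w 0 ≥ c` itself, in at most `0`.
    have h1 : ∀ n, u n ⊓ c ≤ 0 := fun n => by
      have h2 : w (n + 1) ⊓ u n ≤ 0 := (hw (n + 1)).inf_le_of_forall_inf_le (by
        rintro _ ⟨k, rfl⟩
        exact (inf_le_inf_right _ inf_le_left).trans (hd _ _ (by omega)).le)
      exact (le_inf (inf_le_right.trans (hc' (n + 1))) inf_le_left).trans h2
    have h3 : w 0 ⊓ c ≤ 0 := (hw 0).inf_le_of_forall_inf_le (by
      rintro _ ⟨k, rfl⟩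
      exact (inf_le_inf_right _ inf_le_left).trans (h1 _))
    rwa [inf_eq_right.2 (hc' 0)] at h3
  · rw [abs_of_nonneg (hpos n)]
    exact hle n n le_rfl

variable [Module ℝ F] [IsOrderedModule ℝ F]

theorem smul_inf_eq_zero_of_inf_eq_zero {a b : F} (h : a ⊓ b = 0) {t : ℝ} (ht : 0 ≤ t) :
    t • a ⊓ b = 0 := by
  have ha : 0 ≤ a := h ▸ inf_le_left
  have hb : 0 ≤ b := h ▸ inf_le_right
  refine le_antisymm ?_ (le_inf (smul_nonneg ht ha) hb)
  have hM : (0 : ℝ) < t + 1 := by linarith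
  calc t • a ⊓ b ≤ (t + 1) • a ⊓ (t + 1) • b := by
        refine inf_le_inf (smul_le_smul_of_nonneg_right (by linarith) ha) ?_
        rw [add_smul, one_smul]
        exact le_add_of_nonneg_left (smul_nonneg ht hb)
    _ = 0 := by rw [← smul_inf_of_pos hM, h, smul_zero]

/-- The component of `u` in the band generated by `(y - δ u)⁺`. -/
theorem IsSigmaDedekindComplete.exists_component (hF : IsSigmaDedekindComplete F) {y u : F}
    (hy : 0 ≤ y) (hyu : y ≤ u) {δ : ℝ} (hδ : 0 < δ) :
    ∃ w, 0 ≤ w ∧ w ≤ u ∧ (u - w) ⊓ w = 0 ∧ δ • w ≤ y ∧ y ≤ δ • u + w := by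
  have hu : 0 ≤ u := hy.trans hyu
  set a : F := (y - δ • u)⁺ with ha_def
  set d : F := (y - δ • u)⁻ with hd_def
  have ha : 0 ≤ a := posPart_nonneg _
  have hd : 0 ≤ d := negPart_nonneg _
  have had : a ⊓ d = 0 := posPart_inf_negPart_eq_zero _
  have hsub : a - d = y - δ • u := posPart_sub_negPart _
  have hay : a ≤ y := sup_le (sub_le_self _ (smul_nonneg hδ.le hu)) hy
  -- The band projection of `u` is the supremum of the elements `k a ⊓ u`.
  obtain ⟨w, hw⟩ := hF.exists_isLUB_range (fun k : ℕ => (k : ℝ) • a ⊓ u) (b := u)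
    fun _ => inf_le_right
  have hkw : ∀ k : ℕ, (k : ℝ) • a ⊓ u ≤ w := fun k => hw.1 ⟨k, rfl⟩
  have hwu : w ≤ u := hw.2 (by rintro _ ⟨k, rfl⟩; exact inf_le_right)
  have haw : a ≤ w := by simpa [inf_eq_left.2 (hay.trans hyu)] using hkw 1
  have hw0 : 0 ≤ w := ha.trans haw
  -- Doubling `k a ⊓ u` and cutting at `u` stays below `2k a ⊓ u`, again one of the approximants.
  -- This saturation yields `(u - w) ⊓ w = 0`. The inequality is halved so that distributivity
  -- applies to `w`.
  have hdouble : (2 : ℝ) • w ⊓ u ≤ w := by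
    have h1 : w ⊓ (2⁻¹ : ℝ) • u ≤ (2⁻¹ : ℝ) • w := hw.inf_le_of_forall_inf_le (by
      rintro _ ⟨k, rfl⟩
      rw [le_inv_smul_iff_of_pos two_pos, smul_inf_of_pos two_pos, smul_inv_smul₀ two_ne_zero,
        smul_inf_of_pos two_pos, smul_smul]
      refine le_trans (inf_le_inf_right _ inf_le_left) ?_
      simpa using hkw (2 * k))
    rwa [le_inv_smul_iff_of_pos two_pos, smul_inf_of_pos two_pos,
      smul_inv_smul₀ two_ne_zero] at h1
  refine ⟨w, hw0, hwu, ?_, ?_, ?_⟩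
  · refine le_antisymm ?_ (le_inf (sub_nonneg.2 hwu) hw0)
    have h1 : w + (u - w) ⊓ w ≤ (2 : ℝ) • w ⊓ u := by
      rw [two_smul, add_inf, inf_comm, add_sub_cancel]
    simpa using h1.trans hdouble
  · rw [← le_inv_smul_iff_of_pos hδ]
    refine hw.2 ?_
    rintro _ ⟨k, rfl⟩
    rw [le_inv_smul_iff_of_pos hδ, smul_inf_of_pos hδ, smul_smul]
    have ht : 0 ≤ δ * (k : ℝ) := by positivity
    -- The excess of `δ u` over `y` is at most `d`, which is disjoint from every multiple of `a`.
    have huyd : δ • u ≤ y + d := by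
      rw [← sub_nonneg]
      have : y + d - δ • u = a := by rw [← sub_add_cancel a d, hsub]; abel
      exact this ▸ ha
    calc (δ * (k : ℝ)) • a ⊓ δ • u ≤ (δ * (k : ℝ)) • a ⊓ (y + d) := inf_le_inf_left _ huyd
      _ ≤ (δ * (k : ℝ)) • a ⊓ y + (δ * (k : ℝ)) • a ⊓ d :=
        inf_add_le_inf_add_inf (smul_nonneg ht ha) hy hd
      _ ≤ y + 0 := add_le_add inf_le_right (smul_inf_eq_zero_of_inf_eq_zero had ht).le
      _ = y := add_zero y
  · have h1 : y ≤ δ • u + a := sub_le_iff_le_add'.1 (le_posPart _)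
    exact h1.trans (by gcongr)

end VectorLattice

/-! ### Order continuity and almost disjoint sequences in Banach lattices -/

section BanachLattice

open Complexification

theorem norm_le_norm_of_nonneg_of_le {F : Type*} [NormedAddCommGroup F] [Lattice F]
    [IsOrderedAddMonoid F] [HasSolidNorm F] {a b : F} (ha : 0 ≤ a) (hab : a ≤ b) :
    ‖a‖ ≤ ‖b‖ :=
  norm_le_norm_of_abs_le_abs (by rwa [abs_of_nonneg ha, abs_of_nonneg (ha.trans hab)])

/-- In a `σ`-Dedekind complete Banach lattice where decreasing null sequences are norm null, the
same holds for nets. -/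
theorem tendsto_norm_zero_of_antitone {F : Type*} [NormedAddCommGroup F] [Lattice F]
    [IsOrderedAddMonoid F] [HasSolidNorm F] [CompleteSpace F]
    (hF : IsSigmaDedekindComplete F)
    (hseq : ∀ y : ℕ → F, Antitone y → IsGLB (Set.range y) 0 →
      Tendsto (fun n => ‖y n‖) atTop (𝓝 0))
    {κ : Type*} [Preorder κ] [IsDirectedOrder κ] [Nonempty κ] {y : κ → F} (hy : Antitone y)
    (h0 : IsGLB (Set.range y) 0) : Tendsto (fun c => ‖y c‖) atTop (𝓝 0) := by
  have hy0 : ∀ c, 0 ≤ y c := fun c => h0.1 ⟨c, rfl⟩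
  -- Otherwise there is an increasing sequence of indices along which `y` jumps by more than `ε` at
  -- each step. With `m = sup (-y (c n))`, the sequence `y (c n) + m` decreases to `0`, so it is
  -- norm null and bounds the jumps.
  have hosc : ∀ ε > 0, ∃ c, ∀ c' ≥ c, ‖y c - y c'‖ ≤ ε := by
    intro ε hε
    by_contra! hcon
    choose f hf hfε using hcon
    obtain ⟨c₀⟩ := ‹Nonempty κ›
    set c : ℕ → κ := fun n => f^[n] c₀ with hc
    have hcs : ∀ n, c (n + 1) = f (c n) := fun n => Function.iterate_succ_apply' f n c₀
    have hcm : Monotone c := monotone_nat_of_le_succ fun n => by rw [hcs]; exact hf _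
    obtain ⟨m, hm⟩ := hF.exists_isLUB_range (fun n => -y (c n)) (b := 0)
      fun n => neg_nonpos.2 (hy0 _)
    have hlim := hseq (fun n => y (c n) + m) (fun i j hij => by
      have := hy (hcm hij)
      dsimp only
      gcongr) ⟨by
        rintro _ ⟨n, rfl⟩
        have := hm.1 ⟨n, rfl⟩
        exact neg_le_iff_add_nonneg'.1 this, fun b hb => by
        have : m ≤ m - b := hm.2 (by
          rintro _ ⟨n, rfl⟩
          have h1 : b ≤ y (c n) + m := hb ⟨n, rfl⟩
          rw [neg_le_iff_add_nonneg', ← add_sub_assoc]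
          exact sub_nonneg.2 h1)
        simpa using this⟩
    obtain ⟨n, hn⟩ := (hlim.eventually (gt_mem_nhds hε)).exists
    refine absurd (hfε (c n)) (not_lt.2 (le_trans ?_ hn.le))
    rw [← hcs]
    refine norm_le_norm_of_nonneg_of_le (sub_nonneg.2 (hy (hcm n.le_succ))) ?_
    have h1 : -y (c (n + 1)) ≤ m := hm.1 ⟨n + 1, rfl⟩
    rw [sub_eq_add_neg]
    gcongr
  have hcau : Cauchy (map y atTop) := by
    refine Metric.cauchy_iff.2 ⟨inferInstance, fun ε hε => ?_⟩
    obtain ⟨c, hc⟩ := hosc (ε / 3) (by positivity)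
    refine ⟨y '' Set.Ici c, image_mem_map (Ici_mem_atTop c), ?_⟩
    rintro _ ⟨a, ha, rfl⟩ _ ⟨b, hb, rfl⟩
    calc dist (y a) (y b) ≤ dist (y c) (y a) + dist (y c) (y b) := dist_triangle_left _ _ _
      _ ≤ ε / 3 + ε / 3 := by
        rw [dist_eq_norm, dist_eq_norm]
        exact add_le_add (hc a ha) (hc b hb)
      _ < ε := by linarith
  obtain ⟨x, hx⟩ := cauchy_map_iff_exists_tendsto.1 hcau
  have hx0 : x = 0 := (isGLB_of_tendsto_atTop hy hx).unique h0
  simpa [hx0] using hx.norm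

/-- A sequence of positive elements whose mutual infima are summably small dominates a disjoint
sequence close to it. -/
theorem exists_disjoint_le_of_norm_inf_le {F : Type*} [NormedAddCommGroup F] [Lattice F]
    [IsOrderedAddMonoid F] [HasSolidNorm F] [CompleteSpace F]
    {z : ℕ → F} (hz : ∀ n, 0 ≤ z n) {δ : ℝ}
    (hzz : ∀ m n, m ≠ n → ‖z m ⊓ z n‖ ≤ δ / 2 / 2 ^ m) :
    ∃ d : ℕ → F, (∀ n, 0 ≤ d n) ∧ (∀ n, d n ≤ z n) ∧ (∀ m n, m ≠ n → d m ⊓ d n = 0) ∧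
      ∀ n, ‖z n‖ - δ ≤ ‖d n‖ := by
  -- Subtracting from `z n` the sum `s n` of all its overlaps leaves `(z n - s n)⁺ ≤ z n - z m ⊓ z
  -- n` for every `m ≠ n`. The remainders of `z m` and `z n` after removing `z m ⊓ z n` are
  -- disjoint.
  set t : ℕ → ℕ → F := fun n m => if m = n then 0 else z m ⊓ z n with ht
  have ht0 : ∀ n m, 0 ≤ t n m := fun n m => by
    simp only [ht]
    split_ifs
    · exact le_rfl
    · exact le_inf (hz _) (hz _)
  have hδ : 0 ≤ δ := by
    have := (norm_nonneg _).trans (hzz 0 1 zero_ne_one)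
    simp at this
    linarith
  have htb : ∀ n m, ‖t n m‖ ≤ δ / 2 / 2 ^ m := fun n m => by
    simp only [ht]
    split_ifs with h
    · rw [norm_zero]
      positivity
    · exact hzz m n h
  have hgeo : HasSum (fun m : ℕ => δ / 2 / 2 ^ m) δ := hasSum_geometric_two' δ
  have hsum : ∀ n, Summable (t n) := fun n => Summable.of_norm_bounded hgeo.summable (htb n)
  set s : ℕ → F := fun n => ∑' m, t n m with hs
  have hsn : ∀ n, ‖s n‖ ≤ δ := fun n => tsum_of_norm_bounded hgeo (htb n)
  have hle : ∀ m n, m ≠ n → z m ⊓ z n ≤ s n := fun m n hmn => by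
    have h1 := (hsum n).le_tsum m fun j _ => ht0 n j
    simpa only [ht, if_neg hmn] using h1
  have hd0 : ∀ n, 0 ≤ (z n - s n)⁺ := fun n => posPart_nonneg _
  have hs0 : ∀ n, 0 ≤ s n := fun n => tsum_nonneg (ht0 n)
  have key : ∀ m n, m ≠ n → (z n - s n)⁺ ≤ z n - z m ⊓ z n := fun m n hmn =>
    sup_le (sub_le_sub_left (hle m n hmn) _) (sub_nonneg.2 inf_le_right)
  refine ⟨fun n => (z n - s n)⁺, hd0, fun n => sup_le (sub_le_self _ (hs0 n)) (hz n),
    fun m n hmn => le_antisymm ?_ (le_inf (hd0 m) (hd0 n)), fun n => ?_⟩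
  · rw [← sub_inf_inf_sub_inf (z m) (z n)]
    refine inf_le_inf ?_ (key m n hmn)
    rw [inf_comm (z m)]
    exact key n m hmn.symm
  · have h1 : ‖z n‖ ≤ ‖(z n - s n)⁺ + s n‖ :=
      norm_le_norm_of_nonneg_of_le (hz n) (sub_le_iff_le_add.1 (le_posPart _))
    linarith [h1.trans (norm_add_le _ _), hsn n]

/-! ### Consequences of the σ-Brezis–Lieb property -/

variable {F : Type*} [NormedAddCommGroup F] [NormedSpace ℝ F]
    [Lattice F] [IsOrderedAddMonoid F] [IsOrderedModule ℝ F] [HasSolidNorm F] [CompleteSpace F]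

theorem Complexification.ofReal_sub {F : Type*} [AddCommGroup F] (x y : F) : ofReal (x - y) = ofReal x - ofReal y := by
  ext <;> simp [ofReal]

theorem Complexification.ofReal_add {F : Type*} [AddCommGroup F] (x y : F) : ofReal (x + y) = ofReal x + ofReal y := by
  ext <;> simp [ofReal]

theorem Complexification.abs_modulus_sub_modulus_sub_le (z x : Complexification F) :
    |x.modulus - (z - x).modulus| ≤ z.modulus := by
  refine abs_le'.2 ⟨?_, ?_⟩
  · have h := modulus_add_le z (x - z)
    rw [add_sub_cancel, ← modulus_neg (x - z), neg_sub] at h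
    exact sub_le_iff_le_add.2 h
  · have h := modulus_add_le z (-x)
    rw [← sub_eq_add_neg, modulus_neg] at h
    rw [neg_sub]
    exact sub_le_iff_le_add.2 h

/-- Flipping the sign of `u = y 0` on its component `w n` keeps the modulus, hence the norm, while
moving `u` by exactly `2 w n`. -/
theorem IsSigmaBrezisLiebSpace.tendsto_norm_zero_of_antitone (hF : IsSigmaDedekindComplete F)
    (h : IsSigmaBrezisLiebSpace F) {y : ℕ → F} (hy : Antitone y) (h0 : IsGLB (Set.range y) 0) :
    Tendsto (fun n => ‖y n‖) atTop (𝓝 0) := by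
  have hy0 : ∀ n, 0 ≤ y n := fun n => h0.1 ⟨n, rfl⟩
  set u : F := y 0 with hu
  rw [Metric.tendsto_atTop]
  intro ε hε
  obtain ⟨δ, hδ, hδε⟩ : ∃ δ : ℝ, 0 < δ ∧ δ * ‖u‖ < ε / 2 :=
    exists_pos_mul_lt (half_pos hε) ‖u‖ |>.imp fun δ hδ => ⟨hδ.1, by linarith [hδ.2, mul_comm ‖u‖ δ]⟩
  have hex := fun n => hF.exists_component (hy0 n) (hy (Nat.zero_le n)) hδ
  choose w hw0 hwu hdis hwy hyw using hex
  have hmod : ∀ n, (ofReal (u - (w n + w n)) - ofReal u).modulus = w n + w n := fun n => by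
    rw [← ofReal_sub, modulus_ofReal, sub_sub_cancel_left, abs_neg,
      abs_of_nonneg (add_nonneg (hw0 n) (hw0 n))]
  have huo : UOConverges (fun n => ofReal (u - (w n + w n))) (ofReal u) := by
    intro b hb
    have hc : (0 : ℝ) < δ⁻¹ + δ⁻¹ := by positivity
    refine OrderConverges.of_abs_le_antitone (y := fun n => (δ⁻¹ + δ⁻¹) • y n)
      (fun m n hmn => smul_le_smul_of_nonneg_left (hy hmn) hc.le) ⟨?_, fun c hcl => ?_⟩
      fun n => ?_
    · rintro _ ⟨n, rfl⟩
      exact smul_nonneg hc.le (hy0 n)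
    · have h1 : (δ⁻¹ + δ⁻¹)⁻¹ • c ≤ 0 := h0.2 (by
        rintro _ ⟨n, rfl⟩
        rw [inv_smul_le_iff_of_pos hc]
        exact hcl ⟨n, rfl⟩)
      simpa using (inv_smul_le_iff_of_pos hc).1 h1
    · rw [hmod, abs_of_nonneg (le_inf (add_nonneg (hw0 n) (hw0 n)) hb), add_smul]
      have h1 : w n ≤ δ⁻¹ • y n := (le_inv_smul_iff_of_pos hδ).2 (hwy n)
      exact inf_le_left.trans (add_le_add h1 h1)
  have hnorm : ∀ n, ‖ofReal (u - (w n + w n))‖ = ‖ofReal u‖ := fun n => by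
    rw [norm_ofReal, norm_ofReal, ← norm_abs_eq_norm (u - (w n + w n)), ← sub_sub,
      abs_sub_eq_add_of_inf_eq_zero (hdis n), sub_add_cancel]
  have hlim := h _ _ huo (by simp only [hnorm]; exact tendsto_const_nhds)
  obtain ⟨N, hN⟩ := Metric.tendsto_atTop.1 hlim (ε / 2) (half_pos hε)
  refine ⟨N, fun n hn => ?_⟩
  have h1 := hN n hn
  rw [dist_zero_right, norm_norm, norm_def, hmod] at h1
  rw [dist_zero_right, norm_norm]
  calc ‖y n‖ ≤ ‖δ • u + w n‖ := norm_le_norm_of_nonneg_of_le (hy0 n) (hyw n)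
    _ ≤ ‖δ • u‖ + ‖w n‖ := norm_add_le _ _
    _ ≤ δ * ‖u‖ + ‖w n + w n‖ := by
      rw [norm_smul, Real.norm_of_nonneg hδ.le]
      gcongr
      exact norm_le_norm_of_nonneg_of_le (hw0 n) (le_add_of_nonneg_left (hw0 n))
    _ < ε := by linarith

theorem IsSigmaBrezisLiebSpace.hasOrderContinuousNorm (hF : IsSigmaDedekindComplete F)
    (h : IsSigmaBrezisLiebSpace F) : HasOrderContinuousNorm F := by
  intro κ _ _ _ y hy h0
  simp only [norm_ofReal]
  exact _root_.tendsto_norm_zero_of_antitone hF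
    (fun y hy h0 => h.tendsto_norm_zero_of_antitone hF hy h0) hy h0

theorem IsSigmaBrezisLiebSpace.hasBrezisLiebProperty (hF : IsSigmaDedekindComplete F)
    (h : IsSigmaBrezisLiebSpace F) : HasBrezisLiebProperty F := by
  intro u₀ u hu₀ hu hnorm hd
  by_contra! hcon
  have hmod : ∀ n, (ofReal u₀ + ofReal (u n) - ofReal u₀).modulus = u n := fun n => by
    rw [add_sub_cancel_left, modulus_ofReal, abs_of_nonneg (hu n)]
  have huo : UOConverges (fun n => ofReal u₀ + ofReal (u n)) (ofReal u₀) := fun b hb => by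
    simp only [hmod]
    exact OrderConverges.inf_of_pairwise_disjoint hF hu hd hb
  have hge : ∀ n, ‖ofReal u₀‖ ≤ ‖ofReal u₀ + ofReal (u n)‖ := fun n => by
    rw [← ofReal_add, norm_ofReal, norm_ofReal]
    exact norm_le_norm_of_nonneg_of_le hu₀ (le_add_of_nonneg_right (hu n))
  have hle : ∀ n, ‖ofReal u₀ + ofReal (u n)‖ ≤ ‖ofReal u₀‖ + 1 := fun n =>
    (norm_add_le _ _).trans (by rw [hnorm n])
  have hb1 : IsBoundedUnder (· ≤ ·) atTop fun n => ‖ofReal u₀ + ofReal (u n)‖ :=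
    isBoundedUnder_of ⟨_, hle⟩
  have hb2 : IsBoundedUnder (· ≥ ·) atTop fun n => ‖ofReal u₀ + ofReal (u n)‖ :=
    isBoundedUnder_of ⟨_, hge⟩
  have hlim := h _ _ huo (tendsto_of_le_liminf_of_limsup_le
    (le_liminf_of_le hb1.isCoboundedUnder_ge (Eventually.of_forall hge)) hcon hb1 hb2)
  simp only [add_sub_cancel_left, hnorm] at hlim
  exact one_ne_zero (tendsto_nhds_unique tendsto_const_nhds hlim)

theorem IsBrezisLiebSpace.isSigmaBrezisLiebSpace {F : Type u} [NormedAddCommGroup F]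
    [NormedSpace ℝ F] [Lattice F] [IsOrderedAddMonoid F] [IsOrderedModule ℝ F] [HasSolidNorm F]
    [CompleteSpace F] (h : IsBrezisLiebSpace.{w, u} F) : IsSigmaBrezisLiebSpace F := by
  intro v x huo hlim
  have hdown : Tendsto (ULift.down.{w} : ULift ℕ → ℕ) atTop atTop :=
    tendsto_atTop_atTop.2 fun n => ⟨⟨n⟩, fun _ h => h⟩
  have hup : Tendsto (ULift.up.{w} : ℕ → ULift ℕ) atTop atTop :=
    tendsto_atTop_atTop.2 fun n => ⟨n.down, fun _ h => h⟩
  refine (h (ULift ℕ) (fun n => v n.down) x (fun b hb => ?_) (hlim.comp hdown)).comp hup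
  obtain ⟨κ, i₁, i₂, i₃, y, hy, h0, hv⟩ := huo b hb
  refine ⟨κ, i₁, i₂, i₃, y, hy, h0, fun c => ?_⟩
  obtain ⟨a₀, ha₀⟩ := hv c
  exact ⟨⟨a₀⟩, fun a ha => ha₀ _ ha⟩

/-! ### From the Brezis–Lieb property and order continuity to nets -/

theorem UOConverges.eventually_norm_inf_lt (hoc : HasOrderContinuousNorm F) {ι : Type*}
    [Preorder ι] [IsDirectedOrder ι] {v : ι → Complexification F}
    {x : Complexification F} (h : UOConverges v x) {u : F} (hu : 0 ≤ u) {η : ℝ} (hη : 0 < η) :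
    ∀ᶠ a in atTop, ‖(v a - x).modulus ⊓ u‖ < η := by
  obtain ⟨κ, _, _, _, y, hy, h0, hv⟩ := h u hu
  obtain ⟨c, hc⟩ := ((hoc κ y hy h0).eventually (gt_mem_nhds hη)).exists
  obtain ⟨a₀, ha₀⟩ := hv c
  filter_upwards [Ici_mem_atTop a₀] with a ha
  rw [norm_ofReal] at hc
  refine lt_of_le_of_lt (norm_le_norm_of_nonneg_of_le (le_inf (modulus_nonneg _) hu) ?_) hc
  have h1 := ha₀ a ha
  rw [sub_zero] at h1
  exact (le_abs_self _).trans h1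

/-- The Brezis-Lieb property excludes disjoint sequences `d` bounded away from `0` with
`‖u₀ + d n‖` asymptotically bounded by `‖u₀‖`. -/
theorem HasBrezisLiebProperty.not_forall_norm_add_le (hbl : HasBrezisLiebProperty F) {u₀ : F}
    (hu₀ : 0 ≤ u₀) {d : ℕ → F} (hd0 : ∀ n, 0 ≤ d n) (hdd : ∀ m n, m ≠ n → d m ⊓ d n = 0)
    {ε : ℝ} (hε : 0 < ε) (hdε : ∀ n, ε ≤ ‖d n‖) :
    ¬ ∀ n : ℕ, ‖u₀ + d n‖ ≤ ‖u₀‖ + 1 / ((n : ℝ) + 1) := by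
  intro hle
  have hpos : ∀ n, 0 < ‖d n‖ := fun n => hε.trans_le (hdε n)
  have hu : ∀ n, 0 ≤ ‖d n‖⁻¹ • d n := fun n => smul_nonneg (inv_nonneg.2 (hpos n).le) (hd0 n)
  -- Since `‖d n‖ ≥ ε`, the normalised `d n` lies below `ε⁻¹ d n`; scaling `u₀` by the same factor
  -- lets the bound on `‖u₀ + d n‖` be used.
  have hKu : (0 : F) ≤ ε⁻¹ • u₀ := smul_nonneg (inv_nonneg.2 hε.le) hu₀
  have h1 := hbl (ε⁻¹ • u₀) (fun n => ‖d n‖⁻¹ • d n) hKu hu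
    (fun n => by
      rw [norm_ofReal, norm_smul, norm_inv, norm_norm, inv_mul_cancel₀ (hpos n).ne'])
    (fun m n hmn => by
      refine smul_inf_eq_zero_of_inf_eq_zero ?_ (inv_nonneg.2 (hpos m).le)
      rw [inf_comm]
      exact smul_inf_eq_zero_of_inf_eq_zero (hdd n m hmn.symm) (inv_nonneg.2 (hpos n).le))
  refine absurd h1 (not_lt.2 ?_)
  have hbound : ∀ n : ℕ, ‖ofReal (ε⁻¹ • u₀) + ofReal (‖d n‖⁻¹ • d n)‖ ≤
      ε⁻¹ * (‖u₀‖ + 1 / ((n : ℝ) + 1)) := fun n => by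
    rw [← ofReal_add, norm_ofReal]
    calc ‖ε⁻¹ • u₀ + ‖d n‖⁻¹ • d n‖ ≤ ‖ε⁻¹ • (u₀ + d n)‖ := by
          refine norm_le_norm_of_nonneg_of_le (add_nonneg hKu (hu n)) ?_
          rw [smul_add]
          exact add_le_add le_rfl
            (smul_le_smul_of_nonneg_right (inv_anti₀ hε (hdε n)) (hd0 n))
      _ = ε⁻¹ * ‖u₀ + d n‖ := by rw [norm_smul, Real.norm_of_nonneg (inv_nonneg.2 hε.le)]
      _ ≤ _ := by
        gcongr
        exact hle n
  have hlim : Tendsto (fun n : ℕ => ε⁻¹ * (‖u₀‖ + 1 / ((n : ℝ) + 1))) atTop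
      (𝓝 ‖ofReal (ε⁻¹ • u₀)‖) := by
    rw [norm_ofReal, norm_smul, Real.norm_of_nonneg (inv_nonneg.2 hε.le)]
    simpa using (tendsto_one_div_add_atTop_nhds_zero_nat (𝕜 := ℝ)).const_add ‖u₀‖ |>.const_mul ε⁻¹
  rw [← hlim.limsup_eq]
  exact limsup_le_limsup (Eventually.of_forall hbound)
    (isBoundedUnder_of ⟨0, fun n => norm_nonneg _⟩ : IsBoundedUnder (· ≥ ·) _ _).isCoboundedUnder_le
    hlim.isBoundedUnder_le

theorem HasBrezisLiebProperty.tendsto_norm_sub (hbl : HasBrezisLiebProperty F)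
    (hoc : HasOrderContinuousNorm F) {ι : Type*} [Preorder ι] [IsDirectedOrder ι] [Nonempty ι]
    {v : ι → Complexification F} {x : Complexification F} (huo : UOConverges v x)
    (hlim : Tendsto (fun a => ‖v a‖) atTop (𝓝 ‖x‖)) :
    Tendsto (fun a => ‖v a - x‖) atTop (𝓝 0) := by
  by_contra hcon
  obtain ⟨ε, hε, hfreq⟩ : ∃ ε > 0, ∃ᶠ a in atTop, ε ≤ ‖v a - x‖ := by
    simp only [Metric.tendsto_nhds, dist_zero_right, norm_norm] at hcon
    push Not at hcon
    exact hcon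
  set z : ι → F := fun a => (v a - x).modulus with hz
  have hz0 : ∀ a, 0 ≤ z a := fun a => modulus_nonneg _
  have hx0 : 0 ≤ x.modulus := modulus_nonneg x
  have hadd : ∀ η > 0, ∀ᶠ a in atTop, ‖x.modulus + z a‖ ≤ ‖x.modulus‖ + η := by
    intro η hη
    filter_upwards [hlim.eventually (gt_mem_nhds (show ‖x‖ < ‖x‖ + η / 3 by linarith)),
      huo.eventually_norm_inf_lt hoc hx0 (show 0 < η / 3 by linarith)] with a ha hb
    -- A sum exceeds the absolute difference by twice the infimum, and `||x| - z a| ≤ |v a|`.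
    have h1 : x.modulus + z a ≤ (v a).modulus + (z a ⊓ x.modulus + z a ⊓ x.modulus) := by
      rw [← sub_le_iff_le_add, inf_comm (z a), add_sub_two_inf_eq_abs_sub]
      exact abs_modulus_sub_modulus_sub_le _ _
    have h2 := norm_le_norm_of_nonneg_of_le (add_nonneg hx0 (hz0 a)) h1
    have h3 := (norm_add_le (v a).modulus (z a ⊓ x.modulus + z a ⊓ x.modulus)).trans
      (add_le_add le_rfl (norm_add_le _ _))
    rw [norm_def, norm_def] at ha
    linarith
  -- Each choice carries a strictly increasing counter that controls both the norm excess and the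
  -- overlap with the finitely many earlier choices. No cofinal sequence in `ι` is needed.
  obtain ⟨f, hP, hr⟩ := exists_seq_of_forall_finset_exists
    (fun p : ℕ × ι => ε ≤ ‖z p.2‖ ∧ ‖x.modulus + z p.2‖ ≤ ‖x.modulus‖ + 1 / ((p.1 : ℝ) + 1))
    (fun p q => p.1 < q.1 ∧ ‖z q.2 ⊓ z p.2‖ ≤ ε / 2 / 2 / 2 ^ q.1) (by
      intro s _
      set N : ℕ := s.sup Prod.fst + 1 with hN
      have hev : ∀ᶠ a in atTop, ∀ p ∈ s, ‖z a ⊓ z p.2‖ ≤ ε / 2 / 2 / 2 ^ N :=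
        (Filter.eventually_all_finset s).2 fun p _ =>
          (huo.eventually_norm_inf_lt hoc (hz0 p.2) (by positivity)).mono fun _ h => h.le
      obtain ⟨a, ha, hb, hc⟩ := (hfreq.and_eventually
        ((hadd (1 / ((N : ℝ) + 1)) (by positivity)).and hev)).exists
      exact ⟨(N, a), ⟨ha, hb⟩, fun p hp =>
        ⟨Nat.lt_succ_of_le (Finset.le_sup (f := Prod.fst) hp), hc p hp⟩⟩)
  have hmono : StrictMono fun n => (f n).1 := fun m n hmn => (hr m n hmn).1
  have hid : ∀ n, n ≤ (f n).1 := fun _ => hmono.le_apply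
  have hpow : ∀ m n : ℕ, m ≤ n → ε / 2 / 2 / 2 ^ n ≤ ε / 2 / 2 / 2 ^ m := fun m n hmn => by
    gcongr
    norm_num
  -- Taking `δ = ε / 2` leaves `‖d n‖ ≥ ε / 2`. The overlap bound carries the counter of the later
  -- index, which is at least both `m` and `n`.
  obtain ⟨d, hd0, hdz, hdd, hdn⟩ := exists_disjoint_le_of_norm_inf_le
    (z := fun n => z (f n).2) (fun n => hz0 _) (δ := ε / 2) (fun m n hmn => by
      rcases hmn.lt_or_gt with h | h
      · rw [inf_comm]
        exact (hr m n h).2.trans (hpow _ _ (h.le.trans (hid n)))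
      · exact (hr n m h).2.trans (hpow _ _ (hid m)))
  refine hbl.not_forall_norm_add_le hx0 hd0 hdd (half_pos hε)
    (fun n => by linarith [hdn n, (hP n).1]) fun n => ?_
  calc ‖x.modulus + d n‖ ≤ ‖x.modulus + z (f n).2‖ :=
        norm_le_norm_of_nonneg_of_le (add_nonneg hx0 (hd0 n)) (add_le_add le_rfl (hdz n))
    _ ≤ _ := (hP n).2
    _ ≤ _ := by
      have : (n : ℝ) ≤ (f n).1 := by exact_mod_cast hid n
      gcongr

end BanachLattice

theorem theorem2p6 (F : Type u) [NormedAddCommGroup F] [NormedSpace ℝ F]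
    [Lattice F] [IsOrderedAddMonoid F] [IsOrderedModule ℝ F] [HasSolidNorm F] [CompleteSpace F]
    (hF : IsSigmaDedekindComplete F) :
    List.TFAE [
      IsBrezisLiebSpace.{w, u} F,
      IsSigmaBrezisLiebSpace F,
      HasBrezisLiebProperty F ∧ HasOrderContinuousNorm F] := by
  tfae_have 1 → 2 := IsBrezisLiebSpace.isSigmaBrezisLiebSpace
  tfae_have 2 → 3 := fun h => ⟨h.hasBrezisLiebProperty hF, h.hasOrderContinuousNorm hF⟩
  tfae_have 3 → 1 := fun h ι _ _ _ v x huo hlim => h.1.tendsto_norm_sub h.2 huo hlim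
  tfae_finish
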